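/- A matching of length $n\ge 0$ is a partition of $\{1,\dots,2n\}$ into $n$ blocks of size two, called arcs and written $[a,b]$ with $a<b$; $a$ is the opener and $b$ the closer. It is a Stoimenow matching if it has no two arcs $[i,\ell],[i+1,k]$ with $k<\ell$ and no two arcs $[k,j+1],[\ell,j]$ with $k<\ell$. Let $\mathcal M_n(P_2)$ be the set of Stoimenow matchings of length $n$ that avoid the pattern $P_2=\{[1,3],[2,5],[4,7],[6,8]\}$, i.e. that do not contain four arcs $[a_i,b_i]$ ($1\le i\le 4$) with $a_1<a_2<b_1<a_3<b_2<a_4<b_3<b_4$. For a Stoimenow matching $M$ let $\Omega(M)$ be the poset whose elements are the arcs of $M$, with $[a,b]<[a',b']$ if and only if $b<a'$; it is $(\mathbf{2+2})$-free. For a finite $(\mathbf{2+2})$-free poset $P$, the strict down-sets $D(x)=\{y : y<x\}$ form a chain $\emptyset=D_0\subsetneq D_1\subsetneq\dots\subsetneq D_t$, and $x$ is said to be at level $i$ if $D(x)=D_i$. Define a sequence $\mathcal O(P)$ of length $|P|$ recursively (the bijection of Bousquet-Mélou, Claesson, Dukes and Kitaev). For the empty poset it is the empty sequence. Otherwise let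 $i$ be the smallest level that contains a maximal element of $P$, and let $P'$ be obtained from $P$ as follows. If level $i$ has at least two elements, or if $i=t$, remove a maximal element at level $i$. If level $i$ has exactly one element and $i<t$, delete all relations $x<y$ with $x\in D_{i+1}\setminus D_i$ and then remove the element at level $i$. Then $P'$ is $(\mathbf{2+2})$-free and does not depend, up to isomorphism, on the choice made, and $\mathcal O(P)$ is $\mathcal O(P')$ followed by the entry $i$. Put $\Psi=\mathcal O\circ\Omega$. An ascent sequence of length $n$ is a sequence $(\alpha_1,\dots,\alpha_n)$ of nonnegative integers with $\alpha_1=0$ (if $n\ge1$) and $\alpha_i\le 1+\mathrm{asc}(\alpha_1,\dots,\alpha_{i-1})$ for $2\le i\le n$, where $\mathrm{asc}$ counts the indices $j$ with $\alpha_j<\alpha_{j+1}$. Let $\mathcal A_n(101)$ be the set of ascent sequences of length $n$ that avoid the pattern $101$, i.e. for which there are no $i<j<k$ with $\alpha_i=\alpha_k>\alpha_j$. **Theorem.** For every $n\ge 0$, the map $\Psi$ restricted to $\mathcal M_n(P_2)$ is a bijection from $\mathcal M_n(P_2)$ onto $\mathcal A_n(101)$. -/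

import Mathlib

/-! ### Matchings -/

/-- A matching on `2n` points (the points `1, …, 2n` are represented by `Fin (2 * n)`), i.e. a
partition of the points into blocks of size two, given by the map that sends each point to the
other point of its block. -/
@[ext]
structure ArcMatching (n : ℕ) where
  partner : Fin (2 * n) → Fin (2 * n)
  partner_partner : ∀ x, partner (partner x) = x
  partner_ne : ∀ x, partner x ≠ x

namespace ArcMatching

variable {n : ℕ}

/-- `[a, b]` is an arc of `M`, with opener `a` and closer `b`. -/
def IsArc (M : ArcMatching n) (a b : Fin (2 * n)) : Prop :=
  a < b ∧ M.partner a = b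

/-- No Type I arcs (an arc nested in another one, with adjacent openers) and no Type II arcs
(an arc nested in another one, with adjacent closers). -/
def IsStoimenow (M : ArcMatching n) : Prop :=
  (∀ a b c d, M.IsArc a b → M.IsArc c d → ¬ ((c : ℕ) = (a : ℕ) + 1 ∧ d < b)) ∧
  (∀ a b c d, M.IsArc a b → M.IsArc c d → ¬ (a < c ∧ (b : ℕ) = (d : ℕ) + 1))

/-- `M` contains the pattern `P₂ = {[1,3], [2,5], [4,7], [6,8]}`. -/
def ContainsP2 (M : ArcMatching n) : Prop :=
  ∃ a₁ b₁ a₂ b₂ a₃ b₃ a₄ b₄, M.IsArc a₁ b₁ ∧ M.IsArc a₂ b₂ ∧ M.IsArc a₃ b₃ ∧ M.IsArc a₄ b₄ ∧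
    a₁ < a₂ ∧ a₂ < b₁ ∧ b₁ < a₃ ∧ a₃ < b₂ ∧ b₂ < a₄ ∧ a₄ < b₃ ∧ b₃ < b₄

end ArcMatching

/-- The set `M_n(P₂)` of Stoimenow matchings with `n` arcs that avoid `P₂`. -/
def stoimenowAvoidingP2 (n : ℕ) : Set (ArcMatching n) :=
  {M | M.IsStoimenow ∧ ¬ M.ContainsP2}

/-! ### Finite posets -/

/-- A finite poset whose elements are labelled by elements of `ι`; `rel` is the graph of its
strict order. -/
@[ext]
structure FinPoset (ι : Type*) where
  carrier : Finset ι
  rel : Finset (ι × ι)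
  mem_of_rel : ∀ x y, (x, y) ∈ rel → x ∈ carrier ∧ y ∈ carrier
  irrefl : ∀ x, (x, x) ∉ rel
  trans : ∀ x y z, (x, y) ∈ rel → (y, z) ∈ rel → (x, z) ∈ rel

namespace FinPoset

variable {ι : Type*} [LinearOrder ι]

/-- The strict down-set `D(x)`. -/
def down (P : FinPoset ι) (x : ι) : Finset ι :=
  P.carrier.filter fun y => (y, x) ∈ P.rel

/-- The collection of strict down-sets of the elements of `P`.
If `P` is `(2+2)`-free, it is a chain `∅ = D₀ ⊂ D₁ ⊂ ⋯ ⊂ D_t`. -/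
def downSets (P : FinPoset ι) : Finset (Finset ι) :=
  P.carrier.image P.down

/-- The level of `x`: the index `i` with `D(x) = D_i`, i.e. the number of
strict down-sets properly contained in `D(x)`. -/
def level (P : FinPoset ι) (x : ι) : ℕ :=
  (P.downSets.filter fun D => D ⊂ P.down x).card

/-- The highest level `t` of a nonempty poset. -/
def topLevel (P : FinPoset ι) : ℕ :=
  P.downSets.card - 1

/-- The set of elements at level `i`. -/
def atLevel (P : FinPoset ι) (i : ℕ) : Finset ι :=
  P.carrier.filter fun x => P.level x = i

/-- The set of maximal elements. -/
def maximals (P : FinPoset ι) : Finset ι :=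
  P.carrier.filter fun x => ∀ y ∈ P.carrier, (x, y) ∉ P.rel

/-- The minimum level of a maximal element (`0` for the empty poset). -/
def minMaxLevel (P : FinPoset ι) : ℕ :=
  if h : P.maximals.Nonempty then P.maximals.inf' h P.level else 0

/-- The maximal elements that lie at the minimum level of a maximal element. They all have the
same strict down-set and nothing above them, so automorphisms of `P` permute them transitively
(when `P` is `(2+2)`-free). -/
def lowMaximals (P : FinPoset ι) : Finset ι :=
  P.maximals.filter fun x => P.level x = P.minMaxLevel

/-- The difference `D_{i+1} \ D_i` of consecutive strict down-sets. -/
def downDiff (P : FinPoset ι) (i : ℕ) : Finset ι :=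
  (P.atLevel (i + 1)).biUnion P.down \ (P.atLevel i).biUnion P.down

/-- Delete all relations `x < y` with `x ∈ N`. -/
def deleteRel (P : FinPoset ι) (N : Finset ι) : FinPoset ι where
  carrier := P.carrier
  rel := P.rel.filter fun p => p.1 ∉ N
  mem_of_rel x y h := P.mem_of_rel x y (Finset.mem_filter.1 h).1
  irrefl x h := P.irrefl x (Finset.mem_filter.1 h).1
  trans x y z h h' := Finset.mem_filter.2
    ⟨P.trans x y z (Finset.mem_filter.1 h).1 (Finset.mem_filter.1 h').1,
      (Finset.mem_filter.1 h).2⟩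

/-- Remove the element `m`. -/
def erase (P : FinPoset ι) (m : ι) : FinPoset ι where
  carrier := P.carrier.erase m
  rel := P.rel.filter fun p => p.1 ≠ m ∧ p.2 ≠ m
  mem_of_rel x y h :=
    ⟨Finset.mem_erase.2 ⟨(Finset.mem_filter.1 h).2.1,
        (P.mem_of_rel x y (Finset.mem_filter.1 h).1).1⟩,
      Finset.mem_erase.2 ⟨(Finset.mem_filter.1 h).2.2,
        (P.mem_of_rel x y (Finset.mem_filter.1 h).1).2⟩⟩
  irrefl x h := P.irrefl x (Finset.mem_filter.1 h).1
  trans x y z h h' := Finset.mem_filter.2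
    ⟨P.trans x y z (Finset.mem_filter.1 h).1 (Finset.mem_filter.1 h').1,
      (Finset.mem_filter.1 h).2.1, (Finset.mem_filter.1 h').2.2⟩

/-- One removal step of Bousquet-Mélou, Claesson, Dukes and Kitaev. Let `i` be the minimum level
of a maximal element.
* If there are at least two elements at level `i`, or if `i` is the highest level, remove a maximal
  element at level `i` (any choice gives the same poset up to isomorphism; the one with the
  smallest label is taken).
* If there is just one element at level `i` and `i` is not the highest level, first make every
  element of `D_{i+1} \ D_i` maximal by deleting all relations `x < y` with `x` in that set, then
  remove the element at level `i`. -/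
def removeStep (P : FinPoset ι) : FinPoset ι :=
  if h : P.lowMaximals.Nonempty then
    if (P.atLevel P.minMaxLevel).card = 1 ∧ P.minMaxLevel < P.topLevel then
      (P.deleteRel (P.downDiff P.minMaxLevel)).erase (P.lowMaximals.min' h)
    else
      P.erase (P.lowMaximals.min' h)
  else P

/-- Record the minimum level of a maximal element before each of `k` successive removal steps;
the last recorded value is the first entry of the sequence. -/
def removalLevels : ℕ → FinPoset ι → List ℕ
  | 0, _ => []
  | k + 1, P => removalLevels k P.removeStep ++ [P.minMaxLevel]

/-- The map `O` from `(2+2)`-free posets to ascent sequences: the last entry of `O(P)` is the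
minimum level of a maximal element of `P`, the preceding entries are `O(P')`, where `P'` arises
from `P` by a removal step. -/
def toAscentSeq (P : FinPoset ι) : List ℕ :=
  removalLevels P.carrier.card P

end FinPoset

/-! ### The maps `Ω` and `Ψ` -/

namespace ArcMatching

variable {n : ℕ}

/-- The map `Ω`: the poset on the arcs of `M` (each labelled by its opener) in which
`[a, b] < [a', b']` if and only if `b < a'`. -/
def toPoset (M : ArcMatching n) : FinPoset (Fin (2 * n)) where
  carrier := Finset.univ.filter fun a => a < M.partner a
  rel := Finset.univ.filter fun p =>
    p.1 < M.partner p.1 ∧ p.2 < M.partner p.2 ∧ M.partner p.1 < p.2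
  mem_of_rel x y h := by
    simp only [Finset.mem_filter, Finset.mem_univ, true_and] at h ⊢
    exact ⟨h.1, h.2.1⟩
  irrefl x h := by
    simp only [Finset.mem_filter, Finset.mem_univ, true_and] at h
    exact absurd (h.1.trans h.2.2) (lt_irrefl x)
  trans x y z h h' := by
    simp only [Finset.mem_filter, Finset.mem_univ, true_and] at h h' ⊢
    exact ⟨h.1, h'.2.1, h.2.2.trans (h.2.1.trans h'.2.2)⟩

/-- The composite `Ψ = O ∘ Ω`. -/
def toAscentSeq (M : ArcMatching n) : List ℕ :=
  M.toPoset.toAscentSeq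

end ArcMatching

/-! ### Ascent sequences -/

/-- The number of ascents of a sequence, i.e. of indices `i` with `α_i < α_{i+1}`. -/
def ascents (l : List ℕ) : ℕ :=
  (l.zip l.tail).countP fun p => p.1 < p.2

/-- `l` is an ascent sequence of length `n`. -/
def IsAscentSeq (n : ℕ) (l : List ℕ) : Prop :=
  l.length = n ∧ (∀ h : 0 < l.length, l[0] = 0) ∧
    ∀ i (h : i < l.length), 1 ≤ i → l[i] ≤ 1 + ascents (l.take i)

/-- `l` contains the pattern `101`: it has a subsequence `a, b, a` with `b < a`. -/
def Contains101 (l : List ℕ) : Prop :=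
  ∃ a b, b < a ∧ [a, b, a].Sublist l

/-- The set `A_n(101)` of ascent sequences of length `n` that avoid `101`. -/
def ascentSeqAvoiding101 (n : ℕ) : Set (List ℕ) :=
  {l | IsAscentSeq n l ∧ ¬ Contains101 l}

/-! Cut the points of a matching into runs, a new run starting wherever an opener directly follows a
closer, and send each arc to the interval [run of its opener, run of its closer]. This is an
interval representation of Ω(M). In a Stoimenow matching, avoiding P₂ forces these intervals to be
laminar (`laminar_of_stoimenow_of_avoids`), and then every singleton [v, v] occurs among them
(`exists_code`).

List the intervals by right end, then by decreasing left end. The singletons make the level of an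
element its left end, so the last interval [i, t] is a maximal element of least level. If i < t, the
singleton [i, i] is a second element at level i, so a removal step only erases the last interval
(`exists_removeStep`). Hence Ψ(M) is the list of left ends.

The right ends are the running maxima of the left ends, so nothing is lost (`eq_of_map_fst_eq`). The
lists of left ends are exactly the 101-avoiding restricted growth sequences, which are the
101-avoiding ascent sequences, as every ascent introduces a new value (`mem_iff_le_ascents`).
Finally, a Stoimenow matching is determined by its multiset of intervals (`eq_of_map_arcRuns_eq`),
and sorting the endpoints of a laminar code yields a matching with that code. -/

/-- A list of intervals `[p.1, p.2]`, sorted by increasing right end and then decreasing left end,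
that is laminar (no two of its intervals cross or abut) and has all relevant singletons. -/
structure IsLaminarCode (L : List (ℕ × ℕ)) : Prop where
  le : ∀ p ∈ L, p.1 ≤ p.2
  laminar : ∀ p ∈ L, ∀ q ∈ L, p.1 < q.1 → q.1 ≤ p.2 → q.2 ≤ p.2
  diag : ∀ p ∈ L, ∀ v ≤ p.2, (v, v) ∈ L
  sorted : L.Pairwise fun p q => p.2 < q.2 ∨ p.2 = q.2 ∧ q.1 ≤ p.1

/-! ### 101-avoiding ascent sequences as restricted growth sequences -/

/-- Every value below an entry occurs before that entry. -/
def IsRestrictedGrowth (l : List ℕ) : Prop :=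
  ∀ i (h : i < l.length), ∀ v < l[i], v ∈ l.take i

theorem contains101_iff (l : List ℕ) :
    Contains101 l ↔ ∃ i j k, ∃ (hij : i < j) (hjk : j < k) (hk : k < l.length),
      l[i] = l[k] ∧ l[j] < l[k] := by
  constructor
  · rintro ⟨a, b, hab, h⟩
    obtain ⟨f, hf⟩ := List.sublist_iff_exists_fin_orderEmbedding_get_eq.1 h
    have h0 := hf ⟨0, by simp⟩
    have h1 := hf ⟨1, by simp⟩
    have h2 := hf ⟨2, by simp⟩
    simp only [List.get_eq_getElem, List.getElem_cons_zero, List.getElem_cons_succ] at h0 h1 h2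
    have h01 : f ⟨0, by simp⟩ < f ⟨1, by simp⟩ := f.strictMono (by simp)
    have h12 : f ⟨1, by simp⟩ < f ⟨2, by simp⟩ := f.strictMono (by simp)
    exact ⟨_, _, _, h01, h12, (f ⟨2, by simp⟩).2, by rw [← h0, ← h2], by rw [← h1, ← h2]; exact hab⟩
  · rintro ⟨i, j, k, hij, hjk, hk, h1, h2⟩
    refine ⟨l[k], l[j], h2, ?_⟩
    have : [l[k], l[j], l[k]] = List.map l.get [⟨i, by omega⟩, ⟨j, by omega⟩, ⟨k, hk⟩] := by
      simp [h1]
    rw [this]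
    apply List.map_getElem_sublist
    simp [hij, hjk, hij.trans hjk]

theorem Contains101.mono {l l' : List ℕ} (h : Contains101 l) (hl : l.Sublist l') :
    Contains101 l' := by
  obtain ⟨a, b, hab, hs⟩ := h
  exact ⟨a, b, hab, hs.trans hl⟩

theorem ascents_concat (l : List ℕ) (b a : ℕ) :
    ascents (l ++ [b] ++ [a]) = ascents (l ++ [b]) + if b < a then 1 else 0 := by
  induction l with
  | nil => simp [ascents, List.countP_cons]
  | cons c l ih =>
    cases l with
    | nil => simp [ascents, List.countP_cons]; omega
    | cons d l =>
      simp only [ascents, List.cons_append, List.tail_cons, List.zip_cons_cons,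
        List.countP_cons] at ih ⊢
      omega

theorem IsRestrictedGrowth.of_concat {l : List ℕ} {a : ℕ} (h : IsRestrictedGrowth (l ++ [a])) :
    IsRestrictedGrowth l ∧ ∀ v < a, v ∈ l := by
  constructor
  · intro i hi v hv
    have := h i (by simp; omega) v (by rwa [List.getElem_append_left hi])
    rwa [List.take_append_of_le_length hi.le] at this
  · intro v hv
    have := h l.length (by simp) v (by simpa using hv)
    simpa using this

/-- An ascent from `b` to a value `a` seen before would create `a, b, a`. So ascents are exactly the
first occurrences of nonzero values, and restricted growth makes these appear in the order 1, 2, ….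
-/
theorem mem_iff_le_ascents (l : List ℕ) (hl : l ≠ []) (hg : IsRestrictedGrowth l)
    (h101 : ¬ Contains101 l) (v : ℕ) : v ∈ l ↔ v ≤ ascents l := by
  induction l using List.reverseRecOn generalizing v with
  | nil => exact absurd rfl hl
  | append_singleton l a ih =>
    obtain ⟨hg', ha⟩ := hg.of_concat
    rcases List.eq_nil_or_concat l with rfl | ⟨l, b, rfl⟩
    · have : a = 0 := by
        by_contra h
        simpa using ha 0 (by omega)
      subst this
      simp [ascents]
    · simp only [List.concat_eq_append] at *
      have ih := fun v => ih (by simp) hg' (fun h => h101 (h.mono (by simp))) v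
      rw [ascents_concat, List.mem_append, ih v, List.mem_singleton]
      have hb := (ih b).1 (by simp)
      by_cases hal : a ∈ l ++ [b]
      · have hba : ¬ b < a := by
          intro hba
          have hal' : a ∈ l := by
            rcases List.mem_append.1 hal with h | h
            · exact h
            · simp at h; omega
          apply h101
          refine ⟨a, b, hba, ?_⟩
          have := (List.singleton_sublist.2 hal').append (List.Sublist.refl [b, a])
          simpa using this
        have := (ih a).1 hal
        simp [hba]
        omega
      · have h1 : ¬ a ≤ ascents (l ++ [b]) := fun h => hal ((ih a).2 h)
        have h2 : a ≤ ascents (l ++ [b]) + 1 := by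
          by_contra h
          have := (ih _).1 (ha (a - 1) (by omega))
          omega
        simp [show b < a by omega]
        omega

theorem isRestrictedGrowth_take {l : List ℕ} (h : IsRestrictedGrowth l) (i : ℕ) :
    IsRestrictedGrowth (l.take i) := by
  intro j hj v hv
  simp only [List.length_take, lt_inf_iff] at hj
  have := h j hj.2 v (by simpa using hv)
  rwa [List.take_take, min_eq_left hj.1.le]

theorem isRestrictedGrowth_of_isAscentSeq {n : ℕ} {l : List ℕ} (h : IsAscentSeq n l)
    (h101 : ¬ Contains101 l) : IsRestrictedGrowth l := by
  obtain ⟨-, h0, h1⟩ := h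
  intro i
  induction i using Nat.strong_induction_on with
  | _ i ih =>
    intro hi v hv
    rcases Nat.eq_zero_or_pos i with rfl | hpos
    · rw [h0 hi] at hv; omega
    · have hg : IsRestrictedGrowth (l.take i) := by
        intro j hj v hv
        simp only [List.length_take, lt_inf_iff] at hj
        have := ih j hj.1 hj.2 v (by simpa using hv)
        rwa [List.take_take, min_eq_left hj.1.le]
      rw [mem_iff_le_ascents _ (by rw [← List.length_pos_iff]; simp; omega) hg
        (fun h => h101 (h.mono (List.take_sublist _ _)))]
      have := h1 i hi hpos
      omega

theorem isAscentSeq_of_isRestrictedGrowth {l : List ℕ} (h : IsRestrictedGrowth l)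
    (h101 : ¬ Contains101 l) : IsAscentSeq l.length l := by
  refine ⟨rfl, fun h0 => ?_, fun i hi hpos => ?_⟩
  · by_contra hne
    simpa using h 0 h0 0 (by omega)
  · by_contra hlt
    have := h i hi (l[i] - 1) (by omega)
    rw [mem_iff_le_ascents _ (by rw [← List.length_pos_iff]; simp; omega)
      (isRestrictedGrowth_take h i) (fun h => h101 (h.mono (List.take_sublist _ _)))] at this
    omega

/-! ### Laminar codes and their left ends -/

namespace IsLaminarCode

theorem of_concat {L : List (ℕ × ℕ)} {p : ℕ × ℕ} (h : IsLaminarCode (L ++ [p])) :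
    IsLaminarCode L where
  le q hq := h.le q (by simp [hq])
  laminar q hq q' hq' := h.laminar q (by simp [hq]) q' (by simp [hq'])
  diag q hq v hv := by
    have h1 := h.diag q (by simp [hq]) v hv
    rcases List.mem_append.1 h1 with h1 | h1
    · exact h1
    · have h2 := (List.pairwise_append.1 h.sorted).2.2 q hq p (by simp)
      have h3 := h.le q (by simp [hq])
      rw [List.mem_singleton] at h1
      subst h1
      have : q = (v, v) := by ext <;> simp at * <;> omega
      exact this ▸ hq
  sorted := (List.pairwise_append.1 h.sorted).1

theorem getElem_rel {L : List (ℕ × ℕ)} (h : IsLaminarCode L) {i j : ℕ} (hij : i < j)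
    (hj : j < L.length) : L[i].2 < L[j].2 ∨ L[i].2 = L[j].2 ∧ L[j].1 ≤ L[i].1 :=
  List.pairwise_iff_getElem.1 h.sorted i j _ hj hij

theorem fst_le_snd {L : List (ℕ × ℕ)} (h : IsLaminarCode L) {i j : ℕ} (hij : i ≤ j)
    (hj : j < L.length) : L[i].1 ≤ L[j].2 := by
  have h1 := h.le L[i] (by simp)
  rcases hij.eq_or_lt with rfl | hij
  · exact h1
  · have := h.getElem_rel hij hj
    omega

/-- The singleton `[v, v]` comes no later than any interval with right end at least `v`. -/
theorem exists_diag_le {L : List (ℕ × ℕ)} (h : IsLaminarCode L) {k v : ℕ} (hk : k < L.length)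
    (hv : v ≤ L[k].2) : ∃ j, ∃ (hj : j ≤ k), L[j] = (v, v) := by
  obtain ⟨j, hj, hjv⟩ := List.getElem_of_mem (h.diag L[k] (by simp) v hv)
  by_cases hjk : j ≤ k
  · exact ⟨j, hjk, hjv⟩
  · have h1 := h.getElem_rel (not_le.1 hjk) hj
    have h2 := h.le L[k] (by simp)
    rw [hjv] at h1
    refine ⟨k, le_rfl, ?_⟩
    ext <;> simp at * <;> omega

/-- The right end at `k` is the maximum of the left ends up to `k`: it bounds them because the list
is sorted, and a singleton at or before `k` attains it. -/
theorem eq_of_map_fst_eq {L L' : List (ℕ × ℕ)} (h : IsLaminarCode L) (h' : IsLaminarCode L')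
    (heq : L.map Prod.fst = L'.map Prod.fst) : L = L' := by
  have hlen : L.length = L'.length := by simpa using congrArg List.length heq
  have hfst : ∀ k (hk : k < L.length), L[k].1 = (L'[k]'(hlen ▸ hk)).1 := by
    intro k hk
    have : (L.map Prod.fst)[k]'(by simpa) = (L'.map Prod.fst)[k]'(by simpa [← hlen]) := by
      simp only [heq]
    simpa using this
  apply List.ext_getElem hlen
  intro k hk hk'
  ext
  · exact hfst k hk
  · apply le_antisymm
    · obtain ⟨j, hj, hjv⟩ := h.exists_diag_le hk le_rfl
      have := h'.fst_le_snd hj hk'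
      rw [← hfst j (by omega), hjv] at this
      exact this
    · obtain ⟨j, hj, hjv⟩ := h'.exists_diag_le hk' le_rfl
      have := h.fst_le_snd hj hk
      rw [hfst j (by omega), hjv] at this
      exact this

theorem map_fst_mem {L : List (ℕ × ℕ)} (h : IsLaminarCode L) :
    L.map Prod.fst ∈ ascentSeqAvoiding101 L.length := by
  have h101 : ¬ Contains101 (L.map Prod.fst) := by
    rw [contains101_iff]
    rintro ⟨i, j, k, hij, hjk, hk, h1, h2⟩
    simp only [List.length_map] at hk
    simp only [List.getElem_map] at h1 h2
    -- Since `L[j].1 < L[k].1 = L[i].1 ≤ L[j].2`, laminarity puts interval `k` inside interval `j`,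
    -- against the order of the list.
    have h3 := h.getElem_rel hjk hk
    have h4 := h.fst_le_snd hij.le (by omega)
    have h5 := h.laminar L[j] (by simp) L[k] (by simp) h2 (by omega)
    omega
  have hg : IsRestrictedGrowth (L.map Prod.fst) := by
    intro k hk v hv
    simp only [List.length_map] at hk
    simp only [List.getElem_map] at hv
    have h1 := h.le L[k] (by simp)
    obtain ⟨j, hj, hjv⟩ := h.exists_diag_le hk (v := v) (by omega)
    have hjk : j ≠ k := by
      rintro rfl
      rw [hjv] at hv
      exact lt_irrefl _ hv
    rw [List.mem_take_iff_getElem]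
    exact ⟨j, by simp; omega, by simp [hjv]⟩
  refine ⟨?_, h101⟩
  simpa using isAscentSeq_of_isRestrictedGrowth hg h101

end IsLaminarCode

/-- The right ends are taken to be the running maxima `m` of the sequence. -/
theorem exists_isLaminarCode {n : ℕ} {l : List ℕ} (hl : l ∈ ascentSeqAvoiding101 n) :
    ∃ L, IsLaminarCode L ∧ L.map Prod.fst = l := by
  obtain ⟨hasc, h101⟩ := hl
  have hg := isRestrictedGrowth_of_isAscentSeq hasc h101
  rw [contains101_iff] at h101
  have hg' : ∀ k (hk : k < l.length), ∀ v < l[k], ∃ j, ∃ (hj : j < k), l[j] = v := by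
    intro k hk v hv
    obtain ⟨j, hj, hjv⟩ := List.mem_take_iff_getElem.1 (hg k hk v hv)
    exact ⟨j, by omega, hjv⟩
  have hM : ∀ k : Fin l.length, ∃ m, (∀ j, ∀ (hj : j ≤ k.1), l[j] ≤ m) ∧
      ∃ j, ∃ (hj : j ≤ k.1), l[j] = m := by
    intro k
    obtain ⟨j, hj, hmax⟩ := Finset.exists_max_image (Finset.Iic k) (fun j => l[j.1])
      ⟨k, by simp⟩
    refine ⟨l[j.1], fun i hi => ?_, j.1, by simpa using hj, rfl⟩
    exact hmax ⟨i, by omega⟩ (by simpa [Fin.le_def] using hi)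
  choose m hm hm' using hM
  have hmono : ∀ j k : Fin l.length, j ≤ k → m j ≤ m k := by
    intro j k hjk
    obtain ⟨i, hi, hij⟩ := hm' j
    rw [← hij]
    exact hm k i (by rw [Fin.le_def] at hjk; omega)
  -- every value up to the running maximum has occurred
  have hocc : ∀ k : Fin l.length, ∀ v ≤ m k, ∃ j, ∃ (hj : j ≤ k.1), l[j] = v := by
    intro k v hv
    obtain ⟨i, hi, hij⟩ := hm' k
    rcases hv.eq_or_lt with rfl | hv
    · exact ⟨i, hi, hij⟩
    · obtain ⟨j, hj, hjv⟩ := hg' i (by omega) v (by omega)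
      exact ⟨j, by omega, hjv⟩
  -- Otherwise `l[k]` would already have occurred at some `i ≤ j`, and `i, j, k` would form the
  -- pattern 101.
  have hlam : ∀ j k : Fin l.length, j < k → l[j.1] < l[k.1] → m j < l[k.1] := by
    intro j k hjk hlt
    by_contra hle
    obtain ⟨i, hi, hiv⟩ := hocc j l[k.1] (by omega)
    have : i ≠ j.1 := by
      rintro rfl
      omega
    exact h101 ⟨i, j, k, by omega, hjk, k.2, hiv, hlt⟩
  refine ⟨List.ofFn fun k : Fin l.length => (l[k.1], m k), ⟨?_, ?_, ?_, ?_⟩, ?_⟩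
  · simp only [List.forall_mem_ofFn_iff]
    exact fun k => hm k k le_rfl
  · simp only [List.forall_mem_ofFn_iff]
    intro j k h1 h2
    by_contra h3
    have hjk : j < k := by
      by_contra h
      exact h3 (hmono k j (not_lt.1 h))
    have := hlam j k hjk h1
    omega
  · simp only [List.forall_mem_ofFn_iff]
    intro k v hv
    classical
    have hex : ∃ j, ∃ (hj : j < l.length), l[j] = v := by
      obtain ⟨j, hj, hjv⟩ := hocc k v hv
      exact ⟨j, by omega, hjv⟩
    -- At the first occurrence of `v` the running maximum is `v`: a larger earlier entry would need
    -- a still earlier `v`.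
    obtain ⟨hj, hjv⟩ := Nat.find_spec hex
    have hmin := fun i => Nat.find_min (m := i) hex
    set j := Nat.find hex
    rw [List.mem_ofFn]
    refine ⟨⟨j, hj⟩, ?_⟩
    have hmj : m ⟨j, hj⟩ = v := by
      apply le_antisymm
      · by_contra hlt
        obtain ⟨i, hi, hiv⟩ := hm' ⟨j, hj⟩
        simp only at hi
        obtain ⟨i', hi', hiv'⟩ := hg' i (by omega) v (by omega)
        exact hmin i' (by omega) ⟨by omega, hiv'⟩
      · rw [← hjv]
        exact hm ⟨j, hj⟩ j le_rfl
    simpa [hmj] using hjv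
  · rw [List.pairwise_ofFn]
    intro j k hjk
    rcases (hmono j k hjk.le).lt_or_eq with h | h
    · exact Or.inl h
    · refine Or.inr ⟨h, ?_⟩
      by_contra hlt
      have h1 := hlam j k hjk (by simpa using hlt)
      have h2 := hm k k le_rfl
      omega
  · apply List.ext_getElem <;> simp

/-! ### The removal step on a laminar interval representation -/

namespace FinPoset

variable {ι : Type*}

/-- `f` is an interval representation of `P`, whose multiset of intervals is listed by `L`. -/
structure IsRepresentedBy (P : FinPoset ι) (f : ι → ℕ × ℕ) (L : List (ℕ × ℕ)) : Prop where
  rel_iff : ∀ x ∈ P.carrier, ∀ y ∈ P.carrier, (x, y) ∈ P.rel ↔ (f x).2 < (f y).1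
  map_eq : P.carrier.val.map f = L

namespace IsRepresentedBy

variable {P : FinPoset ι} {f : ι → ℕ × ℕ} {L : List (ℕ × ℕ)}

theorem mem_iff (h : P.IsRepresentedBy f L) (p : ℕ × ℕ) : p ∈ L ↔ ∃ x ∈ P.carrier, f x = p := by
  rw [← Multiset.mem_coe, ← h.map_eq]
  simp

theorem mem (h : P.IsRepresentedBy f L) {x : ι} (hx : x ∈ P.carrier) : f x ∈ L :=
  (h.mem_iff _).2 ⟨x, hx, rfl⟩

variable {p : ℕ × ℕ} (h : P.IsRepresentedBy f (L ++ [p])) (hL : IsLaminarCode (L ++ [p]))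

include h hL

theorem exists_diag {v : ℕ} (hv : v ≤ p.2) : ∃ x ∈ P.carrier, f x = (v, v) :=
  (h.mem_iff _).1 (hL.diag p (by simp) v hv)

theorem le_last {x : ι} (hx : x ∈ P.carrier) :
    (f x).2 < p.2 ∨ (f x).2 = p.2 ∧ p.1 ≤ (f x).1 := by
  rcases List.mem_append.1 (h.mem hx) with h1 | h1
  · exact (List.pairwise_append.1 hL.sorted).2.2 _ h1 p (by simp)
  · rw [List.mem_singleton.1 h1]
    exact Or.inr ⟨rfl, le_rfl⟩

theorem fst_le_snd {x : ι} (hx : x ∈ P.carrier) : (f x).1 ≤ (f x).2 :=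
  hL.le _ (h.mem hx)

theorem fst_le_last {x : ι} (hx : x ∈ P.carrier) : (f x).1 ≤ p.2 := by
  have h1 := h.fst_le_snd hL hx
  have h2 := h.le_last hL hx
  omega

/-- The element represented by `(u, u)` separates the threshold `u` from every larger one. Hence the
strict down-sets correspond to the thresholds `0, …, p.2`. -/
theorem filter_ssubset_iff {u v : ℕ} (hu : u ≤ p.2) :
    (P.carrier.filter fun y => (f y).2 < u) ⊂ (P.carrier.filter fun y => (f y).2 < v) ↔
      u < v := by
  constructor
  · intro hss
    by_contra hle
    apply hss.2
    intro y
    simp only [Finset.mem_filter]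
    exact fun hy => ⟨hy.1, by omega⟩
  · intro hlt
    obtain ⟨x, hx, hxu⟩ := h.exists_diag hL hu
    refine Finset.ssubset_iff_subset_ne.2 ⟨?_, ?_⟩
    · intro y
      simp only [Finset.mem_filter]
      exact fun hy => ⟨hy.1, by omega⟩
    · intro heq
      have : x ∈ P.carrier.filter fun y => (f y).2 < v := by simp [hx, hxu, hlt]
      rw [← heq] at this
      simp [hxu] at this

theorem filter_injOn :
    Set.InjOn (fun v => P.carrier.filter fun y => (f y).2 < v) (Finset.range (p.2 + 1)) := by
  intro u hu v hv heq
  simp only [Finset.coe_range, Set.mem_Iio] at hu hv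
  have h1 := h.filter_ssubset_iff hL (u := u) (v := v) (by omega)
  have h2 := h.filter_ssubset_iff hL (u := v) (v := u) (by omega)
  simp only at heq
  rw [heq] at h1 h2
  simp only [ssubset_irrefl, false_iff] at h1 h2
  omega

omit hL in
theorem exists_last : ∃ x ∈ P.carrier, f x = p := (h.mem_iff p).1 (by simp)

variable [LinearOrder ι]

omit hL in
theorem down_eq {x : ι} (hx : x ∈ P.carrier) :
    P.down x = P.carrier.filter fun y => (f y).2 < (f x).1 := by
  ext y
  simp only [down, Finset.mem_filter]
  exact and_congr_right fun hy => h.rel_iff y hy x hx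

theorem downSets_eq : P.downSets =
    (Finset.range (p.2 + 1)).image fun v => P.carrier.filter fun y => (f y).2 < v := by
  ext D
  simp only [downSets, Finset.mem_image, Finset.mem_range]
  constructor
  · rintro ⟨x, hx, rfl⟩
    exact ⟨(f x).1, by have := h.fst_le_last hL hx; omega, (h.down_eq hx).symm⟩
  · rintro ⟨v, hv, rfl⟩
    obtain ⟨x, hx, hxv⟩ := h.exists_diag hL (v := v) (by omega)
    exact ⟨x, hx, by rw [h.down_eq hx, hxv]⟩

theorem topLevel_eq : P.topLevel = p.2 := by
  rw [topLevel, h.downSets_eq hL, Finset.card_image_of_injOn (h.filter_injOn hL)]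
  simp

theorem level_eq {x : ι} (hx : x ∈ P.carrier) : P.level x = (f x).1 := by
  have hle := h.fst_le_last hL hx
  have : P.downSets.filter (fun D => D ⊂ P.down x) =
      (Finset.range (f x).1).image fun v => P.carrier.filter fun y => (f y).2 < v := by
    ext D
    rw [h.downSets_eq hL, h.down_eq hx]
    simp only [Finset.mem_filter, Finset.mem_image, Finset.mem_range]
    constructor
    · rintro ⟨⟨v, hv, rfl⟩, hss⟩
      exact ⟨v, (h.filter_ssubset_iff hL (by omega)).1 hss, rfl⟩
    · rintro ⟨v, hv, rfl⟩
      exact ⟨⟨v, by omega, rfl⟩, (h.filter_ssubset_iff hL (by omega)).2 hv⟩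
  rw [level, this, Finset.card_image_of_injOn, Finset.card_range]
  apply (h.filter_injOn hL).mono
  simp only [Finset.coe_range]
  exact Set.Iio_subset_Iio (by omega)

theorem mem_maximals_iff (x : ι) : x ∈ P.maximals ↔ x ∈ P.carrier ∧ (f x).2 = p.2 := by
  simp only [maximals, Finset.mem_filter]
  refine and_congr_right fun hx => ⟨fun hmax => ?_, fun heq y hy => ?_⟩
  · by_contra hne
    obtain ⟨y, hy, hyp⟩ := h.exists_diag hL le_rfl
    apply hmax y hy
    rw [h.rel_iff x hx y hy, hyp]
    have := h.le_last hL hx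
    simp
    omega
  · rw [h.rel_iff x hx y hy, heq]
    exact not_lt.2 (h.fst_le_last hL hy)

theorem minMaxLevel_eq : P.minMaxLevel = p.1 := by
  obtain ⟨x, hx, hxp⟩ := h.exists_last
  have hxm : x ∈ P.maximals := (h.mem_maximals_iff hL x).2 ⟨hx, by rw [hxp]⟩
  have hne : P.maximals.Nonempty := ⟨x, hxm⟩
  rw [minMaxLevel, dif_pos hne]
  apply le_antisymm
  · have := Finset.inf'_le P.level hxm
    rwa [h.level_eq hL hx, hxp] at this
  · apply Finset.le_inf'
    intro y hy
    obtain ⟨hy, hyp⟩ := (h.mem_maximals_iff hL y).1 hy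
    rw [h.level_eq hL hy]
    have := h.le_last hL hy
    omega

theorem mem_lowMaximals_iff (x : ι) : x ∈ P.lowMaximals ↔ x ∈ P.carrier ∧ f x = p := by
  simp only [lowMaximals, Finset.mem_filter, h.mem_maximals_iff hL, h.minMaxLevel_eq hL, and_assoc]
  refine and_congr_right fun hx => ?_
  rw [h.level_eq hL hx, Prod.ext_iff, and_comm]

/-- In a laminar poset the removal step always erases one element and no further relations. -/
theorem exists_removeStep : ∃ m ∈ P.carrier, f m = p ∧ P.removeStep = P.erase m := by
  have hne : P.lowMaximals.Nonempty := by
    obtain ⟨x, hx⟩ := h.exists_last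
    exact ⟨x, (h.mem_lowMaximals_iff hL x).2 hx⟩
  obtain ⟨hm, hmp⟩ := (h.mem_lowMaximals_iff hL _).1 (Finset.min'_mem _ hne)
  refine ⟨_, hm, hmp, ?_⟩
  rw [removeStep, dif_pos hne, if_neg]
  rintro ⟨hcard, hlt⟩
  rw [h.minMaxLevel_eq hL] at hcard hlt
  rw [h.topLevel_eq hL] at hlt
  -- The singleton at `p.1` lies at the same level as the erased element but has a smaller right
  -- end, so the level has at least two elements.
  obtain ⟨y, hy, hyp⟩ := h.exists_diag hL hlt.le
  have hmem : ∀ z ∈ P.carrier, (f z).1 = p.1 → z ∈ P.atLevel p.1 := by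
    intro z hz hzp
    simp [atLevel, hz, h.level_eq hL hz, hzp]
  have := Finset.card_le_one.1 hcard.le _ (hmem _ hm (by rw [hmp])) y (hmem y hy (by rw [hyp]))
  rw [← this, hmp] at hyp
  rw [Prod.ext_iff] at hyp
  simp only at hyp
  omega

theorem removeStep : P.removeStep.IsRepresentedBy f L := by
  obtain ⟨m, hm, hmp, heq⟩ := h.exists_removeStep hL
  rw [heq]
  constructor
  · intro x hx y hy
    simp only [erase, Finset.mem_erase, Finset.mem_filter] at hx hy ⊢
    rw [h.rel_iff x hx.2 y hy.2]
    simp [hx.1, hy.1]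
  · have h1 := h.map_eq
    have h2 : P.carrier.val = m ::ₘ (P.carrier.erase m).val := by
      rw [← Finset.insert_val_of_notMem (Finset.notMem_erase m _), Finset.insert_erase hm]
    rw [h2, Multiset.map_cons, hmp, ← Multiset.coe_add, Multiset.coe_singleton,
      add_comm, Multiset.singleton_add, Multiset.cons_inj_right] at h1
    exact h1

omit h hL

theorem removalLevels_eq (h : P.IsRepresentedBy f L) (hL : IsLaminarCode L) :
    P.removalLevels L.length = L.map Prod.fst := by
  induction L using List.reverseRecOn generalizing P with
  | nil => rfl
  | append_singleton L p ih =>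
    rw [List.length_append, List.length_singleton, removalLevels,
      ih (h.removeStep hL) hL.of_concat, h.minMaxLevel_eq hL]
    simp

theorem toAscentSeq_eq (h : P.IsRepresentedBy f L) (hL : IsLaminarCode L) :
    P.toAscentSeq = L.map Prod.fst := by
  rw [← h.removalLevels_eq hL, toAscentSeq]
  congr 1
  have := congrArg Multiset.card h.map_eq
  simpa using this

end IsRepresentedBy

end FinPoset

/-- Every finite multiset of intervals can be listed in the order of a laminar code. -/
theorem exists_sorted_intervals (s : Multiset (ℕ × ℕ)) : ∃ L : List (ℕ × ℕ), s = L ∧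
    L.Pairwise fun p q => p.2 < q.2 ∨ p.2 = q.2 ∧ q.1 ≤ p.1 := by
  let r : ℕ × ℕ → ℕ × ℕ → Prop := fun p q => p.2 < q.2 ∨ p.2 = q.2 ∧ q.1 ≤ p.1
  have : Std.Total r := ⟨fun p q => by simp only [r]; omega⟩
  have : IsTrans _ r := ⟨fun p q s => by simp only [r]; omega⟩
  have : DecidableRel r := fun _ _ => by unfold r; infer_instance
  refine ⟨s.toList.insertionSort r, ?_, List.pairwise_insertionSort r _⟩
  rw [Multiset.coe_eq_coe.2 (List.perm_insertionSort r _), Multiset.coe_toList]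

/-! ### Runs of openers and closers -/

namespace ArcMatching

variable {n : ℕ} (M : ArcMatching n)

/-- The number of positions `z ≤ x` at which an opener immediately follows a closer, i.e. the
index of the run of openers or closers that contains `x`. -/
def run (x : Fin (2 * n)) : ℕ :=
  (Finset.univ.filter fun z =>
    (z < M.partner z ∧ ∃ y : Fin (2 * n), (y : ℕ) + 1 = z ∧ M.partner y < y) ∧ z ≤ x).card

theorem partner_injective : Function.Injective M.partner := fun x y h => by
  rw [← M.partner_partner x, h, M.partner_partner]

theorem lt_partner_or (x : Fin (2 * n)) : x < M.partner x ∨ M.partner x < x :=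
  (M.partner_ne x).symm.lt_or_gt

theorem isArc_of_lt {x : Fin (2 * n)} (h : x < M.partner x) : M.IsArc x (M.partner x) :=
  ⟨h, rfl⟩

theorem isArc_of_gt {x : Fin (2 * n)} (h : M.partner x < x) : M.IsArc (M.partner x) x :=
  ⟨h, M.partner_partner x⟩

theorem run_mono {x y : Fin (2 * n)} (h : x ≤ y) : M.run x ≤ M.run y := by
  apply Finset.card_le_card
  intro z
  simp only [Finset.mem_filter]
  exact fun hz => ⟨hz.1, hz.2.1, hz.2.2.trans h⟩

theorem lt_of_run_lt {x y : Fin (2 * n)} (h : M.run x < M.run y) : x < y := by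
  by_contra hle
  exact absurd (M.run_mono (not_lt.1 hle)) (not_le.2 h)

theorem exists_switch_of_run_lt {x y : Fin (2 * n)} (h : M.run x < M.run y) :
    ∃ z w : Fin (2 * n), x < z ∧ z ≤ y ∧ z < M.partner z ∧ (w : ℕ) + 1 = z ∧ M.partner w < w := by
  by_contra hno
  push Not at hno
  apply absurd h (not_lt.2 _)
  apply Finset.card_le_card
  intro z
  simp only [Finset.mem_filter, Finset.mem_univ, true_and]
  rintro ⟨⟨hz, w, hw, hw'⟩, hzy⟩
  refine ⟨⟨hz, w, hw, hw'⟩, ?_⟩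
  by_contra hxz
  exact absurd hw' (not_lt.2 (hno z w (not_le.1 hxz) hzy hz hw))

/-- The first opener after `b` is directly preceded by a closer, so a new run starts there, at or
before `a`. -/
theorem run_lt {b a : Fin (2 * n)} (hb : M.partner b < b) (ha : a < M.partner a) (hba : b < a) :
    M.run b < M.run a := by
  obtain ⟨z, ⟨hbz, hz⟩, hmin⟩ := WellFounded.has_min (wellFounded_lt (α := Fin (2 * n)))
    {z | b < z ∧ z < M.partner z} ⟨a, hba, ha⟩
  have hza : z ≤ a := not_lt.1 (hmin a ⟨hba, ha⟩)
  apply Finset.card_lt_card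
  refine Finset.ssubset_iff_subset_ne.2 ⟨?_, ?_⟩
  · intro z
    simp only [Finset.mem_filter]
    exact fun hz => ⟨hz.1, hz.2.1, hz.2.2.trans hba.le⟩
  · intro heq
    rw [Finset.ext_iff] at heq
    have := (heq z).2
    simp only [Finset.mem_filter, Finset.mem_univ, true_and] at this
    have h := (this ⟨⟨hz, ⟨z - 1, by omega⟩, by simp; omega, ?_⟩, hza⟩).2
    · exact absurd h (not_le.2 hbz)
    · rcases eq_or_ne b ⟨z - 1, by omega⟩ with h | h
      · rwa [h] at hb
      · rcases M.lt_partner_or ⟨z - 1, by omega⟩ with h' | h'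
        · exfalso
          refine hmin ⟨z - 1, by omega⟩ ⟨?_, h'⟩ ?_
          · rw [Fin.lt_def] at *
            rw [Ne, Fin.ext_iff] at h
            simp only at *
            omega
          · rw [Fin.lt_def] at *
            simp only
            omega
        · exact h'

theorem run_lt_iff {b a : Fin (2 * n)} (hb : M.partner b < b) (ha : a < M.partner a) :
    M.run b < M.run a ↔ b < a :=
  ⟨M.lt_of_run_lt, M.run_lt hb ha⟩

/-- Up to the first closer after `a` there are only openers, so no new run starts. -/
theorem exists_first_closer {a : Fin (2 * n)} (ha : a < M.partner a) :
    ∃ b, M.partner b < b ∧ a < b ∧ M.run b = M.run a := by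
  obtain ⟨b, ⟨hab, hb⟩, hmin⟩ := WellFounded.has_min (wellFounded_lt (α := Fin (2 * n)))
    {b | a < b ∧ M.partner b < b} ⟨M.partner a, ha, by rwa [M.partner_partner]⟩
  refine ⟨b, hb, hab, le_antisymm ?_ (M.run_mono hab.le)⟩
  by_contra hlt
  obtain ⟨z, w, haz, hzb, hz, hw, hw'⟩ := M.exists_switch_of_run_lt (not_le.1 hlt)
  have hne : a ≠ w := by
    rintro rfl
    exact lt_asymm ha hw'
  refine hmin w ⟨?_, hw'⟩ ?_
  · rw [Fin.lt_def] at *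
    rw [Ne, Fin.ext_iff] at hne
    omega
  · rw [Fin.lt_def] at *
    rw [Fin.le_def] at hzb
    omega

theorem exists_last_opener {b : Fin (2 * n)} (hb : M.partner b < b) :
    ∃ a, a < M.partner a ∧ a < b ∧ M.run a = M.run b := by
  obtain ⟨a, ⟨hab, ha⟩, hmax⟩ := WellFounded.has_min (wellFounded_gt (α := Fin (2 * n)))
    {a | a < b ∧ a < M.partner a} ⟨M.partner b, hb, by rwa [M.partner_partner]⟩
  refine ⟨a, ha, hab, le_antisymm (M.run_mono hab.le) ?_⟩
  by_contra hlt
  obtain ⟨z, w, haz, hzb, hz, hw, hw'⟩ := M.exists_switch_of_run_lt (not_le.1 hlt)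
  refine hmax z ⟨lt_of_le_of_ne hzb ?_, hz⟩ haz
  rintro rfl
  exact lt_asymm hz hb

theorem run_succ_le {x y : Fin (2 * n)} (h : (x : ℕ) + 1 = y) : M.run y ≤ M.run x + 1 := by
  unfold run
  rw [← Finset.card_singleton y]
  refine (Finset.card_le_card ?_).trans (Finset.card_union_le _ _)
  intro z
  simp only [Finset.mem_filter, Finset.mem_univ, true_and, Finset.mem_union, Finset.mem_singleton]
  rintro ⟨hz, hzy⟩
  rw [Fin.le_def] at *
  rw [Fin.ext_iff]
  by_cases hzx : (z : ℕ) ≤ x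
  · exact Or.inl ⟨hz, hzx⟩
  · exact Or.inr (by omega)

theorem run_zero {x : Fin (2 * n)} (h : (x : ℕ) = 0) : M.run x = 0 := by
  rw [run, Finset.card_eq_zero, Finset.filter_eq_empty_iff]
  rintro z - ⟨⟨-, y, hy, -⟩, hzx⟩
  rw [Fin.le_def] at hzx
  omega

theorem exists_run_eq {x : Fin (2 * n)} {v : ℕ} (h : v ≤ M.run x) : ∃ z, M.run z = v := by
  obtain ⟨z, hz, hmin⟩ := WellFounded.has_min (wellFounded_lt (α := Fin (2 * n)))
    {z | v ≤ M.run z} ⟨x, h⟩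
  refine ⟨z, le_antisymm ?_ hz⟩
  rcases Nat.eq_zero_or_pos (z : ℕ) with h0 | h0
  · rw [M.run_zero h0]
    exact v.zero_le
  · have h1 := M.run_succ_le (x := ⟨z - 1, by omega⟩) (y := z) (by simp; omega)
    have h2 : ¬ v ≤ M.run ⟨z - 1, by omega⟩ := fun hle =>
      hmin _ hle (by rw [Fin.lt_def]; simp only; omega)
    omega

theorem exists_opener_run_eq {x : Fin (2 * n)} {v : ℕ} (h : v ≤ M.run x) :
    ∃ a, a < M.partner a ∧ M.run a = v := by
  obtain ⟨z, hz⟩ := M.exists_run_eq h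
  rcases M.lt_partner_or z with h' | h'
  · exact ⟨z, h', hz⟩
  · obtain ⟨a, ha, -, hr⟩ := M.exists_last_opener h'
    exact ⟨a, ha, hr.trans hz⟩

theorem exists_closer_run_eq {x : Fin (2 * n)} {v : ℕ} (h : v ≤ M.run x) :
    ∃ b, M.partner b < b ∧ M.run b = v := by
  obtain ⟨a, ha, hr⟩ := M.exists_opener_run_eq h
  obtain ⟨b, hb, -, hr'⟩ := M.exists_first_closer ha
  exact ⟨b, hb, hr'.trans hr⟩

/-! ### Stoimenow matchings avoiding P₂ give laminar codes -/

variable {M}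

/-- In a Stoimenow matching, the arcs with openers in the same run do not nest. -/
theorem IsStoimenow.partner_lt_of_openers (hM : M.IsStoimenow) {a c : Fin (2 * n)}
    (hc : c < M.partner c) (hac : a < c) (hr : M.run a = M.run c) :
    M.partner a < M.partner c := by
  induction c using WellFoundedLT.induction with
  | ind c ih =>
    -- The point before `c` is in the same run, hence an opener; the Type I condition compares its
    -- arc with that of `c`.
    let d : Fin (2 * n) := ⟨c - 1, by omega⟩
    have hdc : (c : ℕ) = (d : ℕ) + 1 := by simp only [d]; rw [Fin.lt_def] at hac; omega
    have hdc' : d < c := by rw [Fin.lt_def]; omega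
    have had : a ≤ d := by rw [Fin.lt_def] at hac; rw [Fin.le_def]; omega
    have hrd : M.run a = M.run d :=
      le_antisymm (M.run_mono had) (hr ▸ M.run_mono hdc'.le)
    have hd : d < M.partner d := by
      rcases M.lt_partner_or d with h | h
      · exact h
      · have := M.run_lt h hc hdc'
        omega
    have hstep : M.partner d < M.partner c := by
      refine lt_of_le_of_ne (not_lt.1 fun h => ?_) fun h => hdc'.ne (M.partner_injective h)
      exact hM.1 d _ c _ (M.isArc_of_lt hd) (M.isArc_of_lt hc) ⟨hdc, h⟩
    rcases had.eq_or_lt with h | h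
    · rwa [h]
    · exact (ih d hdc' hd h hrd).trans hstep

/-- In a Stoimenow matching, the arcs with closers in the same run do not nest. -/
theorem IsStoimenow.partner_lt_of_closers (hM : M.IsStoimenow) {b d : Fin (2 * n)}
    (hb : M.partner b < b) (hd : M.partner d < d) (hbd : b < d) (hr : M.run b = M.run d) :
    M.partner b < M.partner d := by
  induction d using WellFoundedLT.induction with
  | ind d ih =>
    let c : Fin (2 * n) := ⟨d - 1, by omega⟩
    have hcd : (d : ℕ) = (c : ℕ) + 1 := by simp only [c]; rw [Fin.lt_def] at hbd; omega
    have hcd' : c < d := by rw [Fin.lt_def]; omega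
    have hbc : b ≤ c := by rw [Fin.lt_def] at hbd; rw [Fin.le_def]; omega
    have hrc : M.run b = M.run c :=
      le_antisymm (M.run_mono hbc) (hr ▸ M.run_mono hcd'.le)
    rcases hbc.eq_or_lt with h | h
    all_goals
      have hc : M.partner c < c := by
        rcases M.lt_partner_or c with hc | hc
        · first
          | exact absurd hb (not_lt.2 (h ▸ hc.le))
          | have := M.run_lt hb hc h
            omega
        · exact hc
      have hstep : M.partner c < M.partner d := by
        refine lt_of_le_of_ne (not_lt.1 fun h => ?_) fun h => hcd'.ne (M.partner_injective h)
        exact hM.2 _ d _ c (M.isArc_of_gt hd) (M.isArc_of_gt hc) ⟨h, hcd⟩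
    · rwa [h]
    · exact (ih c hcd' hc h hrc).trans hstep

variable (M)

/-- The runs of the opener and of the closer of the arc with opener `a`. -/
def arcRuns (a : Fin (2 * n)) : ℕ × ℕ := (M.run a, M.run (M.partner a))

@[simp]
theorem mem_toPoset_carrier {a : Fin (2 * n)} : a ∈ M.toPoset.carrier ↔ a < M.partner a := by
  simp [toPoset]

theorem mem_toPoset_rel {a c : Fin (2 * n)} : (a, c) ∈ M.toPoset.rel ↔
    a < M.partner a ∧ c < M.partner c ∧ M.partner a < c := by
  simp [toPoset]

variable {M}

/-- If the intervals of `x` and `y` overlapped without nesting, add the arc of the first closer `b`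
after `x` and the arc of the last opener `a` before the closer of `y`. Together the four arcs form
P₂. -/
theorem laminar_of_stoimenow_of_avoids (hM : M.IsStoimenow) (hP : ¬ M.ContainsP2)
    {x y : Fin (2 * n)} (hx : x < M.partner x) (hy : y < M.partner y) (hxy : M.run x < M.run y)
    (hyx : M.run y ≤ M.run (M.partner x)) : M.run (M.partner y) ≤ M.run (M.partner x) := by
  by_contra hlt
  rw [not_le] at hlt
  have hx' : M.partner (M.partner x) < M.partner x := by rwa [M.partner_partner]
  have hy' : M.partner (M.partner y) < M.partner y := by rwa [M.partner_partner]
  have hyx' : y < M.partner x := by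
    refine lt_of_le_of_ne (not_lt.1 fun h => ?_) fun h => ?_
    · have := M.run_lt hx' hy h
      omega
    · rw [← h] at hx'
      exact lt_asymm hx' hy
  obtain ⟨b, hb, hxb, hrb⟩ := M.exists_first_closer hx
  obtain ⟨a, ha, hay, hra⟩ := M.exists_last_opener hy'
  refine hP ⟨M.partner b, b, x, M.partner x, y, M.partner y, a, M.partner a, M.isArc_of_gt hb,
    M.isArc_of_lt hx, M.isArc_of_lt hy, M.isArc_of_lt ha, ?_, hxb, M.lt_of_run_lt (by omega), hyx',
    M.lt_of_run_lt (by omega), hay, ?_⟩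
  -- The arc closing at `b` closes before that of `x`. Were its opener after `x`, it would lie in
  -- the same run and the two arcs would nest.
  · have hbx : b < M.partner x := M.lt_of_run_lt (by omega)
    refine lt_of_le_of_ne (not_lt.1 fun h => ?_) fun h => ?_
    · have hr : M.run (M.partner b) ≤ M.run b := M.run_mono hb.le
      have hr' := M.run_mono h.le
      have := hM.partner_lt_of_openers (by rwa [M.partner_partner]) h (by omega)
      rw [M.partner_partner] at this
      exact lt_asymm this hbx
    · rw [← h, M.partner_partner] at hbx
      exact lt_irrefl _ hbx
  · have hya : y < a := M.lt_of_run_lt (by omega)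
    refine lt_of_le_of_ne (not_lt.1 fun h => ?_) fun h => ?_
    · have hr : M.run a ≤ M.run (M.partner a) := M.run_mono ha.le
      have hr' := M.run_mono h.le
      have := hM.partner_lt_of_closers (by rwa [M.partner_partner]) hy' h (by omega)
      rw [M.partner_partner, M.partner_partner] at this
      exact lt_asymm this hya
    · exact hya.ne (M.partner_injective h)

theorem exists_code (hM : M.IsStoimenow) (hP : ¬ M.ContainsP2) :
    ∃ L, IsLaminarCode L ∧ M.toPoset.IsRepresentedBy M.arcRuns L := by
  obtain ⟨L, hL, hs⟩ := exists_sorted_intervals (M.toPoset.carrier.val.map M.arcRuns)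
  have hrep : M.toPoset.IsRepresentedBy M.arcRuns L := by
    refine ⟨fun x hx y hy => ?_, hL⟩
    rw [mem_toPoset_carrier] at hx hy
    rw [mem_toPoset_rel, arcRuns, arcRuns,
      M.run_lt_iff (by rwa [M.partner_partner]) hy]
    simp [hx, hy]
  refine ⟨L, ⟨?_, ?_, ?_, hs⟩, hrep⟩
  · intro p hp
    obtain ⟨x, hx, rfl⟩ := (hrep.mem_iff p).1 hp
    exact M.run_mono (M.mem_toPoset_carrier.1 hx).le
  · intro p hp q hq
    obtain ⟨x, hx, rfl⟩ := (hrep.mem_iff p).1 hp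
    obtain ⟨y, hy, rfl⟩ := (hrep.mem_iff q).1 hq
    exact laminar_of_stoimenow_of_avoids hM hP (M.mem_toPoset_carrier.1 hx)
      (M.mem_toPoset_carrier.1 hy)
  · intro p hp v hv
    obtain ⟨x, hx, rfl⟩ := (hrep.mem_iff p).1 hp
    obtain ⟨a, ha, hra⟩ := M.exists_opener_run_eq hv
    obtain ⟨b, hb, hrb⟩ := M.exists_closer_run_eq hv
    have hb' : M.partner b < M.partner (M.partner b) := by rwa [M.partner_partner]
    rw [hrep.mem_iff]
    have hle := M.run_mono hb.le
    rw [hrb] at hle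
    -- If the arc closing at `b` starts before run `v`, laminarity makes the arc opening at `a` end
    -- in run `v`; otherwise the arc closing at `b` stays in run `v`.
    rcases hle.lt_or_eq with h | h
    · refine ⟨a, by simpa, Prod.ext hra (le_antisymm ?_ (hra ▸ M.run_mono ha.le))⟩
      have := laminar_of_stoimenow_of_avoids hM hP hb' ha (by omega)
        (by rw [M.partner_partner]; omega)
      rwa [M.partner_partner, hrb] at this
    · exact ⟨M.partner b, by simpa, Prod.ext h (by simp [arcRuns, M.partner_partner, hrb])⟩

/-! ### Recovering a Stoimenow matching from the runs of its arcs -/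

variable (M)

theorem univ_val_eq : (Finset.univ : Finset (Fin (2 * n))).val =
    M.toPoset.carrier.val + M.toPoset.carrier.val.map M.partner := by
  have : Finset.univ = M.toPoset.carrier.disjUnion
      (M.toPoset.carrier.map ⟨M.partner, M.partner_injective⟩) (by
        rw [Finset.disjoint_left]
        intro a ha hb
        obtain ⟨b, hb', rfl⟩ := Finset.mem_map.1 hb
        rw [mem_toPoset_carrier] at ha hb'
        simp only [Function.Embedding.coeFn_mk, M.partner_partner] at ha
        exact lt_asymm ha hb') := by
    ext x
    simp only [Finset.mem_univ, Finset.mem_disjUnion, mem_toPoset_carrier, Finset.mem_map,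
      Function.Embedding.coeFn_mk, true_iff]
    rcases M.lt_partner_or x with h | h
    · exact Or.inl h
    · exact Or.inr ⟨M.partner x, by rwa [M.partner_partner], M.partner_partner x⟩
  rw [this]
  rfl

theorem card_toPoset_carrier : M.toPoset.carrier.card = n := by
  have := congrArg Multiset.card M.univ_val_eq
  simp at this
  omega

/-- The run of `x`, its kind (`0` for openers, `1` for closers) and the run of its partner. -/
def runKey (x : Fin (2 * n)) : ℕ ×ₗ ℕ ×ₗ ℕ :=
  toLex (M.run x, toLex (if x < M.partner x then 0 else 1, M.run (M.partner x)))

variable {M}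

/-- Inside a run openers precede closers, and the absence of nesting makes the partners of points of
one kind increase. Thus the sequence of keys is the sorted list of a multiset determined by the
code. -/
theorem IsStoimenow.monotone_runKey (hM : M.IsStoimenow) : Monotone M.runKey := by
  intro x y hxy
  rcases hxy.eq_or_lt with rfl | hxy
  · rfl
  simp only [runKey, Prod.Lex.toLex_le_toLex]
  rcases (M.run_mono hxy.le).lt_or_eq with h | h
  · exact Or.inl h
  · refine Or.inr ⟨h, ?_⟩
    rcases M.lt_partner_or x with hx | hx <;> rcases M.lt_partner_or y with hy | hy
    · have := M.run_mono (hM.partner_lt_of_openers hy hxy h).le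
      simp [hx, hy, this]
    · simp [hx, hy.not_gt]
    · have := M.run_lt hx hy hxy
      omega
    · have := M.run_mono (hM.partner_lt_of_closers hx hy hxy h).le
      simp [hx.not_gt, hy.not_gt, this]

theorem map_runKey (M : ArcMatching n) : (Finset.univ : Finset (Fin (2 * n))).val.map M.runKey =
    (M.toPoset.carrier.val.map M.arcRuns).map (fun p => toLex (p.1, toLex (0, p.2))) +
    (M.toPoset.carrier.val.map M.arcRuns).map (fun p => toLex (p.2, toLex (1, p.1))) := by
  rw [M.univ_val_eq, Multiset.map_add, Multiset.map_map, Multiset.map_map, Multiset.map_map]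
  congr 1
  · apply Multiset.map_congr rfl
    intro a ha
    have ha : a < M.partner a := M.mem_toPoset_carrier.1 ha
    simp [runKey, arcRuns, ha]
  · apply Multiset.map_congr rfl
    intro a ha
    have ha : a < M.partner a := M.mem_toPoset_carrier.1 ha
    simp [runKey, arcRuns, M.partner_partner, ha.le]

theorem runKey_eq_iff {M' : ArcMatching n} {x : Fin (2 * n)} : M.runKey x = M'.runKey x ↔
    M.run x = M'.run x ∧ (x < M.partner x ↔ x < M'.partner x) ∧
      M.run (M.partner x) = M'.run (M'.partner x) := by
  simp only [runKey, EmbeddingLike.apply_eq_iff_eq, Prod.mk.injEq]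
  by_cases hx : x < M.partner x <;> by_cases hy : x < M'.partner x <;> simp [hx, hy]

/-- As the keys agree, in `M'` the point `M.partner x` closes an arc whose opener is in the run of
`x`. That opener is not before `x`, by `ih`, and is not `x`. After `x`, it would give an arc nested
in the `M'`-arc of `x`, with both openers in one run. -/
theorem IsStoimenow.not_partner_lt {M' : ArcMatching n} (hM' : M'.IsStoimenow)
    (hkey : M.runKey = M'.runKey) {x : Fin (2 * n)} (hx : x < M.partner x)
    (ih : ∀ z < x, z < M.partner z → M.partner z = M'.partner z) :
    ¬ M.partner x < M'.partner x := by
  intro hlt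
  have hk := fun y => runKey_eq_iff.1 (congrFun hkey y)
  have hz : M'.partner (M.partner x) < M'.partner (M'.partner (M.partner x)) := by
    rw [M'.partner_partner]
    refine (M'.lt_partner_or _).resolve_left fun h => ?_
    have := (hk _).2.1.2 h
    rw [M.partner_partner] at this
    exact lt_asymm this hx
  have hrun : M'.run (M'.partner (M.partner x)) = M'.run x := by
    rw [← (hk _).2.2, M.partner_partner, (hk x).1]
  rcases lt_trichotomy (M'.partner (M.partner x)) x with h | h | h
  · have := ih _ h ((hk _).2.1.2 hz)
    rw [M'.partner_partner] at this
    exact h.ne (M.partner_injective this)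
  · rw [← h, M'.partner_partner, h] at hlt
    exact lt_irrefl _ hlt
  · have := hM'.partner_lt_of_openers hz h hrun.symm
    rw [M'.partner_partner] at this
    exact lt_asymm this hlt

/-- A Stoimenow matching is determined by the multiset of pairs of runs of its arcs. -/
theorem IsStoimenow.eq_of_map_arcRuns_eq {M' : ArcMatching n} (hM : M.IsStoimenow)
    (hM' : M'.IsStoimenow)
    (h : M.toPoset.carrier.val.map M.arcRuns = M'.toPoset.carrier.val.map M'.arcRuns) :
    M = M' := by
  have hkey : M.runKey = M'.runKey := by
    apply List.ofFn_injective
    apply List.Perm.eq_of_sortedLE hM.monotone_runKey.sortedLE_ofFn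
      hM'.monotone_runKey.sortedLE_ofFn
    rw [← Multiset.coe_eq_coe, ← Multiset.coe_eq_coe.2 (List.Perm.refl (List.ofFn M'.runKey))]
    have h1 := M.map_runKey
    rw [h, ← M'.map_runKey] at h1
    simpa [List.ofFn_eq_map, ← Multiset.map_coe] using h1
  have hk := fun x => runKey_eq_iff.1 (congrFun hkey x)
  have hop : ∀ x, x < M.partner x → M.partner x = M'.partner x := by
    intro x
    induction x using WellFoundedLT.induction with
    | ind x ih =>
      intro hx
      refine le_antisymm (not_lt.1 (hM.not_partner_lt hkey.symm ((hk x).2.1.1 hx) ?_))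
        (not_lt.1 (hM'.not_partner_lt hkey hx ih))
      exact fun z hzx hz => (ih z hzx ((hk z).2.1.2 hz)).symm
  ext1
  funext x
  rcases M.lt_partner_or x with hx | hx
  · exact hop x hx
  · have := hop (M.partner x) (by rwa [M.partner_partner])
    rw [M.partner_partner] at this
    conv_rhs => rw [this]
    rw [M'.partner_partner]

end ArcMatching

/-! ### The matching of a laminar code -/

theorem exists_equiv_fin_strictMono {α κ : Type*} [Fintype α] [LinearOrder κ] {key : α → κ}
    (hkey : Function.Injective key) {m : ℕ} (hm : Fintype.card α = m) :
    ∃ e : Fin m ≃ α, StrictMono (key ∘ e) := by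
  let _ : LinearOrder α := LinearOrder.lift' key hkey
  exact ⟨(monoEquivOfFin α hm).toEquiv, fun _ _ h => (monoEquivOfFin α hm).strictMono h⟩

/-- The sorting key of the opener (`false`) or closer (`true`) of the `k`-th interval of `L`. -/
def endpointKey (L : List (ℕ × ℕ)) (x : Fin L.length × Bool) : ℕ ×ₗ ℕ ×ₗ ℕ ×ₗ ℕ :=
  match x with
  | (k, false) => toLex (L[k].1, toLex (0, toLex (L[k].2, (k : ℕ))))
  | (k, true) => toLex (L[k].2, toLex (1, toLex (L[k].1, (k : ℕ))))

/-- The index as last coordinate separates the endpoints of repeated intervals. Using it for openers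
and closers alike keeps equal intervals from nesting. -/
theorem endpointKey_injective (L : List (ℕ × ℕ)) : Function.Injective (endpointKey L) := by
  rintro ⟨k, _ | _⟩ ⟨k', _ | _⟩ h <;>
    simp only [endpointKey, EmbeddingLike.apply_eq_iff_eq, Prod.mk.injEq] at h
  · simp [Fin.ext h.2.2.2]
  · omega
  · omega
  · simp [Fin.ext h.2.2.2]

/-- The matching whose points are the endpoints of the intervals of `L`, listed by `e`. -/
def ArcMatching.ofEquiv {n : ℕ} (e : Fin (2 * n) ≃ Fin n × Bool) : ArcMatching n where
  partner x := e.symm ((e x).1, !(e x).2)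
  partner_partner x := by simp
  partner_ne x h := by
    have := congrArg (fun y => (e y).2) h
    simp at this

namespace IsLaminarCode

variable {L : List (ℕ × ℕ)} (hL : IsLaminarCode L)
  {e : Fin (2 * L.length) ≃ Fin L.length × Bool} (he : StrictMono (endpointKey L ∘ e))

include hL he

theorem lt_partner_iff (x : Fin (2 * L.length)) :
    x < (ArcMatching.ofEquiv e).partner x ↔ (e x).2 = false := by
  rw [← he.lt_iff_lt]
  have h := fun k : Fin L.length => hL.le L[k] (by simp)
  simp only [Function.comp, ArcMatching.ofEquiv, Equiv.apply_symm_apply]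
  rcases hx : e x with ⟨k, _ | _⟩
  · simp [endpointKey, Prod.Lex.toLex_lt_toLex]
    exact (h k).lt_or_eq
  · simp [endpointKey, Prod.Lex.toLex_lt_toLex]
    exact h k

theorem exists_of_isArc {a b : Fin (2 * L.length)} (h : (ArcMatching.ofEquiv e).IsArc a b) :
    ∃ k, e a = (k, false) ∧ e b = (k, true) := by
  obtain ⟨hab, rfl⟩ := h
  have h := (hL.lt_partner_iff he a).1 hab
  exact ⟨(e a).1, by rw [← h], by simp [ArcMatching.ofEquiv, h]⟩

theorem isStoimenow_ofEquiv : (ArcMatching.ofEquiv e).IsStoimenow := by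
  constructor
  · rintro a b c d hab hcd ⟨hac, hdb⟩
    obtain ⟨k, ha, hb⟩ := hL.exists_of_isArc he hab
    obtain ⟨k', hc, hd⟩ := hL.exists_of_isArc he hcd
    have hac' : a < c := by rw [Fin.lt_def]; omega
    rw [← he.lt_iff_lt] at hac' hdb
    simp only [Function.comp, ha, hb, hc, hd, endpointKey, Prod.Lex.toLex_lt_toLex] at hac' hdb
    -- Equal left ends would be ordered by right end, then index, excluding nesting. So the left
    -- ends differ, and the closer of the singleton at `L[k].1` falls between the supposedly
    -- adjacent openers.
    have hlt : L[k].1 < L[k'].1 := by omega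
    obtain ⟨j, hj, hjv⟩ := List.getElem_of_mem
      (hL.diag L[k] (by simp) L[k].1 (hL.le _ (by simp)))
    have h1 : a < e.symm (⟨j, hj⟩, true) := by
      rw [← he.lt_iff_lt]
      simp [ha, endpointKey, Prod.Lex.toLex_lt_toLex, hjv]
    have h2 : e.symm (⟨j, hj⟩, true) < c := by
      rw [← he.lt_iff_lt]
      simp only [Function.comp, hc, Equiv.apply_symm_apply, endpointKey, Prod.Lex.toLex_lt_toLex]
      left
      simpa [hjv] using hlt
    rw [Fin.lt_def] at h1 h2
    omega
  · rintro a b c d hab hcd ⟨hac, hdb⟩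
    obtain ⟨k, ha, hb⟩ := hL.exists_of_isArc he hab
    obtain ⟨k', hc, hd⟩ := hL.exists_of_isArc he hcd
    have hdb' : d < b := by rw [Fin.lt_def]; omega
    rw [← he.lt_iff_lt] at hac hdb'
    simp only [Function.comp, ha, hb, hc, hd, endpointKey, Prod.Lex.toLex_lt_toLex] at hac hdb'
    -- Symmetrically, the opener of the singleton at `L[k].2` separates the two closers.
    have hlt : L[k'].2 < L[k].2 := by omega
    obtain ⟨j, hj, hjv⟩ := List.getElem_of_mem (hL.diag L[k] (by simp) L[k].2 le_rfl)
    have h1 : e.symm (⟨j, hj⟩, false) < b := by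
      rw [← he.lt_iff_lt]
      simp [hb, endpointKey, Prod.Lex.toLex_lt_toLex, hjv]
    have h2 : d < e.symm (⟨j, hj⟩, false) := by
      rw [← he.lt_iff_lt]
      simp only [Function.comp, hd, Equiv.apply_symm_apply, endpointKey, Prod.Lex.toLex_lt_toLex]
      left
      simpa [hjv] using hlt
    rw [Fin.lt_def] at h1 h2
    omega

theorem not_containsP2_ofEquiv : ¬ (ArcMatching.ofEquiv e).ContainsP2 := by
  rintro ⟨a₁, b₁, a₂, b₂, a₃, b₃, a₄, b₄, h1, h2, h3, h4, -, hab, hba, hab', hba', hab'', -⟩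
  obtain ⟨k₁, -, hb₁⟩ := hL.exists_of_isArc he h1
  obtain ⟨k₂, ha₂, hb₂⟩ := hL.exists_of_isArc he h2
  obtain ⟨k₃, ha₃, hb₃⟩ := hL.exists_of_isArc he h3
  obtain ⟨k₄, ha₄, -⟩ := hL.exists_of_isArc he h4
  rw [← he.lt_iff_lt] at hab hba hab' hba' hab''
  simp only [Function.comp, ha₂, ha₃, ha₄, hb₁, hb₂, hb₃, endpointKey,
    Prod.Lex.toLex_lt_toLex] at hab hba hab' hba' hab''
  -- The outer arcs force `L[k₂].1 < L[k₃].1` and `L[k₂].2 < L[k₃].2`, while `L[k₃].1 ≤ L[k₂].2`, so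
  -- the middle intervals violate laminarity.
  have := hL.laminar L[k₂] (by simp) L[k₃] (by simp) (by omega) (by omega)
  omega

theorem isRepresentedBy_ofEquiv :
    (ArcMatching.ofEquiv e).toPoset.IsRepresentedBy (fun x => L[(e x).1]) L := by
  constructor
  · intro x hx y hy
    rw [ArcMatching.mem_toPoset_carrier] at hx hy
    rw [ArcMatching.mem_toPoset_rel, and_iff_right hx, and_iff_right hy, ← he.lt_iff_lt]
    rw [hL.lt_partner_iff he] at hx hy
    obtain ⟨k, hk⟩ : ∃ k, e x = (k, false) := ⟨_, by rw [← hx]⟩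
    obtain ⟨k', hk'⟩ : ∃ k, e y = (k, false) := ⟨_, by rw [← hy]⟩
    simp [ArcMatching.ofEquiv, hk, hk', endpointKey, Prod.Lex.toLex_lt_toLex]
  · have : (ArcMatching.ofEquiv e).toPoset.carrier = Finset.univ.map
        ⟨fun k => e.symm (k, false), fun k k' h => by simpa using h⟩ := by
      ext x
      rw [ArcMatching.mem_toPoset_carrier, hL.lt_partner_iff he]
      simp only [Finset.mem_map, Finset.mem_univ, true_and]
      constructor
      · exact fun h => ⟨(e x).1, e.symm_apply_eq.2 (by rw [← h])⟩
      · rintro ⟨k, rfl⟩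
        change (e (e.symm (k, false))).2 = false
        rw [e.apply_symm_apply]
    rw [this, Finset.map_val, Multiset.map_map]
    change Multiset.map (fun k => L[(e (e.symm (k, false))).1]) (List.finRange L.length) = L
    simp only [Equiv.apply_symm_apply]
    rw [Multiset.map_coe, ← List.ofFn_eq_map]
    simp

omit he

theorem exists_matching : ∃ M ∈ stoimenowAvoidingP2 L.length,
    M.toAscentSeq = L.map Prod.fst := by
  obtain ⟨e, he⟩ := exists_equiv_fin_strictMono (endpointKey_injective L)
    (m := 2 * L.length) (by simp [mul_comm])
  exact ⟨_, ⟨hL.isStoimenow_ofEquiv he, hL.not_containsP2_ofEquiv he⟩,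
    (hL.isRepresentedBy_ofEquiv he).toAscentSeq_eq hL⟩

end IsLaminarCode

/-! ### The bijection -/

theorem mainTheorem9 (n : ℕ) :
    Set.BijOn (ArcMatching.toAscentSeq (n := n)) (stoimenowAvoidingP2 n)
      (ascentSeqAvoiding101 n) := by
  refine ⟨?_, ?_, ?_⟩
  · rintro M ⟨hM, hP⟩
    obtain ⟨L, hL, hrep⟩ := ArcMatching.exists_code hM hP
    have hlen : L.length = n := by
      rw [← M.card_toPoset_carrier]
      simpa using (congrArg Multiset.card hrep.map_eq).symm
    rw [ArcMatching.toAscentSeq, hrep.toAscentSeq_eq hL, ← hlen]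
    exact hL.map_fst_mem
  · rintro M ⟨hM, hP⟩ M' ⟨hM', hP'⟩ heq
    obtain ⟨L, hL, hrep⟩ := ArcMatching.exists_code hM hP
    obtain ⟨L', hL', hrep'⟩ := ArcMatching.exists_code hM' hP'
    rw [ArcMatching.toAscentSeq, ArcMatching.toAscentSeq, hrep.toAscentSeq_eq hL,
      hrep'.toAscentSeq_eq hL'] at heq
    apply hM.eq_of_map_arcRuns_eq hM'
    rw [hrep.map_eq, hrep'.map_eq, hL.eq_of_map_fst_eq hL' heq]
  · intro l hl
    obtain ⟨L, hL, rfl⟩ := exists_isLaminarCode hl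
    have hlen : L.length = n := by simpa using hl.1.1
    subst hlen
    exact hL.exists_matching
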